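/- Let $n\ge 0$ be an integer, let $\lambda$ denote Lebesgue measure on $\mathbb{R}^n$, and let $\mathscr{P}_2(\mathbb{R}^n)$ be the set of Borel probability measures $\mu$ on $\mathbb{R}^n$ with $\int \|x\|_2^2\,d\mu(x)<\infty$, with the topology of the 2-Wasserstein distance $$W_2(\mu,\nu)=\Big(\inf_{\pi}\int \|x-y\|_2^2\,d\pi(x,y)\Big)^{1/2},$$ where $\pi$ ranges over all couplings of $\mu$ and $\nu$, that is, measures on $\mathbb{R}^n\times\mathbb{R}^n$ with marginals $\mu$ and $\nu$. Fix $\sigma\in\mathscr{P}_2(\mathbb{R}^n)$ with $\sigma\ll\lambda$, and let $L^2(\mathbb{R}^n,\sigma)$ be the space of ($\sigma$-a.e. classes of) maps $f:\mathbb{R}^n\to\mathbb{R}^n$ with norm $\|f\|_\sigma^2=\int\|f(x)\|_2^2\,d\sigma(x)<\infty$. For $\nu\in\mathscr{P}_2(\mathbb{R}^n)$ let $T_\sigma^\nu\in L^2(\mathbb{R}^n,\sigma)$ be the optimal transport map from $\sigma$ to $\nu$, i.e. the minimizer of $\int\|T(x)-x\|_2^2\,d\sigma(x)$ among all measurable maps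 $T:\mathbb{R}^n\to\mathbb{R}^n$ with $T_\sharp\sigma=\nu$. Then $T_\sigma^\nu$ exists and is unique ($\sigma$-a.e.) for every $\nu$, so that the linear optimal transportation (LOT) map $$F_\sigma:\mathscr{P}_2(\mathbb{R}^n)\to L^2(\mathbb{R}^n,\sigma),\qquad F_\sigma(\nu)=T_\sigma^\nu,$$ is well defined, and: 1. $F_\sigma$ is injective and continuous, and it is a topological embedding, i.e. a homeomorphism onto its image; 2. the image $F_\sigma(\mathscr{P}_2(\mathbb{R}^n))$ is convex in $L^2(\mathbb{R}^n,\sigma)$. -/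

import Mathlib

open MeasureTheory
open scoped ENNReal

noncomputable section

/-- The Borel probability measures on `ℝⁿ` (with the Euclidean norm) with finite second moment. -/
@[ext]
structure P2 (n : ℕ) where
  toMeasure : Measure (EuclideanSpace ℝ (Fin n))
  isProbabilityMeasure : IsProbabilityMeasure toMeasure
  secondMoment_lt_top : ∫⁻ x, ‖x‖ₑ ^ 2 ∂toMeasure < ∞

namespace P2

variable {n : ℕ}

instance (μ : P2 n) : IsProbabilityMeasure μ.toMeasure := μ.isProbabilityMeasure

/-- `π` is a coupling of `μ` and `ν`: its marginals are `μ` and `ν`. -/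
def IsCoupling (π : Measure (EuclideanSpace ℝ (Fin n) × EuclideanSpace ℝ (Fin n)))
    (μ ν : P2 n) : Prop :=
  π.map Prod.fst = μ.toMeasure ∧ π.map Prod.snd = ν.toMeasure

/-- The 2-Wasserstein distance
`W₂(μ, ν) = (inf_π ∫ ‖x - y‖² dπ(x, y)) ^ (1/2)`, infimum over all couplings of `μ` and `ν`. -/
def W2 (μ ν : P2 n) : ℝ≥0∞ :=
  (⨅ (π : Measure (EuclideanSpace ℝ (Fin n) × EuclideanSpace ℝ (Fin n)))
    (_ : IsCoupling π μ ν), ∫⁻ p, ‖p.1 - p.2‖ₑ ^ 2 ∂π) ^ (1 / 2 : ℝ)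

/-- The topology of the 2-Wasserstein distance: a set is open iff it contains, around each of its
points, a Wasserstein ball of positive radius. -/
instance : TopologicalSpace (P2 n) where
  IsOpen U := ∀ μ ∈ U, ∃ ε : ℝ≥0∞, 0 < ε ∧ ∀ ν : P2 n, W2 μ ν < ε → ν ∈ U
  isOpen_univ _ _ := ⟨1, one_pos, fun _ _ => Set.mem_univ _⟩
  isOpen_inter U V hU hV μ hμ := by
    obtain ⟨ε, hε, h⟩ := hU μ hμ.1
    obtain ⟨δ, hδ, h'⟩ := hV μ hμ.2
    exact ⟨min ε δ, lt_min hε hδ, fun ν hν =>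
      ⟨h ν (hν.trans_le (min_le_left _ _)), h' ν (hν.trans_le (min_le_right _ _))⟩⟩
  isOpen_sUnion S hS μ hμ := by
    obtain ⟨U, hU, hμU⟩ := hμ
    obtain ⟨ε, hε, h⟩ := hS U hU μ hμU
    exact ⟨ε, hε, fun ν hν => ⟨U, hU, h ν hν⟩⟩

/-- `T` is an optimal transport map from `σ` to `ν` for the quadratic cost: it pushes `σ` forward
to `ν`, and it minimizes `∫ ‖T x - x‖² dσ(x)` among all maps pushing `σ` forward to `ν`. -/
def IsOptimalTransportMap (σ ν : P2 n)
    (T : EuclideanSpace ℝ (Fin n) → EuclideanSpace ℝ (Fin n)) : Prop :=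
  AEMeasurable T σ.toMeasure ∧ σ.toMeasure.map T = ν.toMeasure ∧
    ∀ S : EuclideanSpace ℝ (Fin n) → EuclideanSpace ℝ (Fin n),
      AEMeasurable S σ.toMeasure → σ.toMeasure.map S = ν.toMeasure →
        ∫⁻ x, ‖T x - x‖ₑ ^ 2 ∂σ.toMeasure ≤ ∫⁻ x, ‖S x - x‖ₑ ^ 2 ∂σ.toMeasure

/-- The linear optimal transportation map `F_σ : ν ↦ T_σ^ν`, with values in `L²(ℝⁿ, σ; ℝⁿ)`
(an arbitrary element is taken where no optimal transport map exists). -/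
def LOT (σ ν : P2 n) : Lp (EuclideanSpace ℝ (Fin n)) 2 σ.toMeasure :=
  Classical.epsilon fun T : Lp (EuclideanSpace ℝ (Fin n)) 2 σ.toMeasure =>
    IsOptimalTransportMap σ ν T

end P2

end

/-! Existence and uniqueness. Weak compactness of the couplings gives an optimal plan. Exchanging
the targets of two independent draws shows that its support is monotone, and a closed monotone graph
is single-valued Lebesgue-a.e. So for `σ ≪ λ` every optimal plan is induced by a map
(`IsOptimalPlan.exists_map`), and averaging two optimal plans shows that they coincide
(`IsOptimalPlan.eq`). No convex potential is needed.

Topology. The pair of maps to `μ` and `ν` pushes `σ` to a coupling of them, so `W2` is at most the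
`L²` distance and the inverse of the LOT map is nonexpansive. Conversely, compactness and uniqueness
force nearly optimal plans to be close to the optimal graph
(`IsOptimalPlan.exists_forall_eLpNorm_le`). A cheap coupling of `μ` and `ν`, lifted along the map to
`μ`, is nearly optimal from `σ` to `ν`; this gives continuity.

Convexity. A map `T` is optimal onto its own image exactly when it satisfies the inequalities of
`IsCorrelationMaximal`, which are linear in `T` and hence survive convex combinations. -/

open Filter Topology ProbabilityTheory
open scoped NNReal RealInnerProductSpace

/-! ### Couplings and gluing. -/

section Coupling

variable {X Y : Type*} [MeasurableSpace X] [MeasurableSpace Y]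

/-- The set of couplings of two measures. -/
def couplings (μ : Measure X) (ν : Measure Y) : Set (Measure (X × Y)) :=
  {π | π.fst = μ ∧ π.snd = ν}

lemma isProbabilityMeasure_of_mem_couplings {μ : Measure X} {ν : Measure Y}
    [IsProbabilityMeasure μ] {π : Measure (X × Y)} (hπ : π ∈ couplings μ ν) :
    IsProbabilityMeasure π := by
  constructor
  rw [← Measure.fst_univ, hπ.1, measure_univ]

/-- The plan induced by a map is a coupling of the source and its image. -/
lemma map_graph_mem_couplings {μ : Measure X} {ν : Measure Y} {T : X → Y}
    (hT : AEMeasurable T μ) (h : μ.map T = ν) :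
    μ.map (fun x => (x, T x)) ∈ couplings μ ν := by
  constructor
  · rw [Measure.fst, AEMeasurable.map_map_of_aemeasurable measurable_fst.aemeasurable
      (aemeasurable_id'.prodMk hT)]
    exact Measure.map_id
  · rw [Measure.snd, AEMeasurable.map_map_of_aemeasurable measurable_snd.aemeasurable
      (aemeasurable_id'.prodMk hT)]
    exact h

/-- **Gluing**: a coupling `γ` of `T_♯ μ` and `ν` lifts to a coupling of `μ` and `ν`. -/
lemma exists_glue [StandardBorelSpace Y] [Nonempty Y] {Z : Type*} [MeasurableSpace Z]
    {μ : Measure X} [IsProbabilityMeasure μ] {ν : Measure Y} {T : X → Z}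
    (hT : AEMeasurable T μ) {γ : Measure (Z × Y)} (hγ : γ ∈ couplings (μ.map T) ν) :
    ∃ m ∈ couplings μ ν, m.map (fun p => (T p.1, p.2)) = γ := by
  have : IsProbabilityMeasure (μ.map T) := Measure.isProbabilityMeasure_map hT
  have := isProbabilityMeasure_of_mem_couplings hγ
  set T' := hT.mk T with hT'
  have hm : Measurable T' := hT.measurable_mk
  -- Draw `x` from `μ`, then `y` from the conditional law of `γ` given its first coordinate `T' x`.
  set m : Measure (X × Y) := μ ⊗ₘ (γ.condKernel.comap T' hm) with hm_def
  have hfst : m.fst = μ := Measure.fst_compProd _ _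
  have hTm : (fun p : X × Y => (T p.1, p.2)) =ᵐ[m] fun p => (T' p.1, p.2) := by
    have : ∀ᵐ x ∂m.map Prod.fst, T x = T' x := by
      rw [← Measure.fst, hfst]; exact hT.ae_eq_mk
    filter_upwards [ae_of_ae_map measurable_fst.aemeasurable this] with p hp
    rw [hp]
  have key : m.map (fun p => (T p.1, p.2)) = γ := by
    rw [Measure.map_congr hTm]
    have hpm : Measurable fun p : X × Y => (T' p.1, p.2) :=
      (hm.comp measurable_fst).prodMk measurable_snd
    refine Measure.ext_of_lintegral _ fun f hf => ?_
    rw [lintegral_map hf hpm, hm_def, Measure.lintegral_compProd (f := fun p => f (T' p.1, p.2)) (hf.comp hpm)]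
    conv_rhs => rw [← Measure.lintegral_condKernel hf, hγ.1, Measure.map_congr hT.ae_eq_mk,
      lintegral_map (by fun_prop) hm]
    simp [Kernel.comap_apply]
  refine ⟨m, ⟨hfst, ?_⟩, key⟩
  rw [← hγ.2, ← key]
  have haem : AEMeasurable (fun p : X × Y => (T p.1, p.2)) m :=
    ⟨_, (hm.comp measurable_fst).prodMk measurable_snd, hTm⟩
  rw [Measure.snd, Measure.snd,
    AEMeasurable.map_map_of_aemeasurable measurable_snd.aemeasurable haem]
  rfl

end Coupling

/-! ### Weak compactness of couplings, semicontinuity of costs. -/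

section Compactness

/-- By monotone convergence the integral is the supremum over `k` of the integrals of the bounded
continuous truncations `min f k`, each weakly continuous in `P`. -/
lemma lowerSemicontinuous_lintegral {Ω : Type*} [MeasurableSpace Ω] [TopologicalSpace Ω]
    [OpensMeasurableSpace Ω] {f : Ω → ℝ≥0} (hf : Continuous f) :
    LowerSemicontinuous fun P : ProbabilityMeasure Ω => ∫⁻ x, f x ∂(P : Measure Ω) := by
  have h : ∀ P : ProbabilityMeasure Ω, ∫⁻ x, f x ∂(P : Measure Ω) =
      ⨆ k : ℕ, ∫⁻ x, (min (f x) k : ℝ≥0) ∂(P : Measure Ω) := by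
    intro P
    rw [← lintegral_iSup]
    · congr 1 with x
      refine le_antisymm ?_ (iSup_le fun k => by exact_mod_cast min_le_left _ _)
      obtain ⟨k, hk⟩ := exists_nat_ge (f x)
      exact le_iSup_of_le k (by simp [min_eq_left hk])
    · exact fun k => (hf.min continuous_const).measurable.coe_nnreal_ennreal
    · intro k l hkl x
      have : (k : ℝ≥0) ≤ l := by exact_mod_cast hkl
      simp only [ENNReal.coe_le_coe]
      exact min_le_min le_rfl this
  simp_rw [h]
  refine lowerSemicontinuous_iSup fun k => Continuous.lowerSemicontinuous ?_
  exact ProbabilityMeasure.continuous_lintegral_boundedContinuousFunction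
    (BoundedContinuousFunction.mkOfBound ⟨fun x => min (f x) k, hf.min continuous_const⟩ k
      fun x y => by
        rw [NNReal.dist_eq, abs_le]
        have h1 : (min (f x) k : ℝ≥0) ≤ k := min_le_right _ _
        have h2 : (min (f y) k : ℝ≥0) ≤ k := min_le_right _ _
        have h1' : ((min (f x) k : ℝ≥0) : ℝ) ≤ k := by exact_mod_cast h1
        have h2' : ((min (f y) k : ℝ≥0) : ℝ) ≤ k := by exact_mod_cast h2
        have := (min (f x) k : ℝ≥0).coe_nonneg
        have := (min (f y) k : ℝ≥0).coe_nonneg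
        simp only [ContinuousMap.coe_mk]
        constructor <;> linarith)

variable {X Y : Type*} [MeasurableSpace X] [MeasurableSpace Y] [TopologicalSpace X]
  [TopologicalSpace Y] [PolishSpace X] [PolishSpace Y] [BorelSpace X] [BorelSpace Y]

/-- The couplings of two probability measures form a weakly compact set. -/
lemma isCompact_couplings (μ : Measure X) (ν : Measure Y) [IsProbabilityMeasure μ]
    [IsProbabilityMeasure ν] :
    IsCompact {P : ProbabilityMeasure (X × Y) | (P : Measure (X × Y)) ∈ couplings μ ν} := by
  have hclosed :
      IsClosed {P : ProbabilityMeasure (X × Y) | (P : Measure (X × Y)) ∈ couplings μ ν} := by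
    let μ' : ProbabilityMeasure X := ⟨μ, inferInstance⟩
    let ν' : ProbabilityMeasure Y := ⟨ν, inferInstance⟩
    have h1 := (isClosed_singleton (x := μ')).preimage
      (ProbabilityMeasure.continuous_map (continuous_fst (X := X) (Y := Y)))
    have h2 := (isClosed_singleton (x := ν')).preimage
      (ProbabilityMeasure.continuous_map (continuous_snd (X := X) (Y := Y)))
    convert h1.inter h2 using 1
    ext P
    simp only [couplings, Set.mem_ofPred_eq, Set.mem_inter_iff, Set.mem_preimage,
      Set.mem_singleton_iff, Measure.fst, Measure.snd]
    exact and_congr (Subtype.ext_iff (a1 := P.map continuous_fst.aemeasurable) (a2 := μ')).symm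
      (Subtype.ext_iff (a1 := P.map continuous_snd.aemeasurable) (a2 := ν')).symm
  rw [← hclosed.closure_eq]
  -- Prokhorov: tightness of a family of couplings follows from that of the two fixed marginals.
  apply isCompact_closure_of_isTightMeasureSet
  rw [isTightMeasureSet_iff_exists_isCompact_measure_compl_le]
  intro ε hε
  have hε2 : 0 < ε / 2 := ENNReal.half_pos hε.ne'
  obtain ⟨K, hK, hμ⟩ := isTightMeasureSet_iff_exists_isCompact_measure_compl_le.1
    (isTightMeasureSet_singleton (μ := μ)) _ hε2
  obtain ⟨L, hL, hν⟩ := isTightMeasureSet_iff_exists_isCompact_measure_compl_le.1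
    (isTightMeasureSet_singleton (μ := ν)) _ hε2
  refine ⟨K ×ˢ L, hK.prod hL, ?_⟩
  rintro _ ⟨P, hP, rfl⟩
  calc (P : Measure (X × Y)) (K ×ˢ L)ᶜ
      ≤ (P : Measure (X × Y)) (Prod.fst ⁻¹' Kᶜ ∪ Prod.snd ⁻¹' Lᶜ) := by
        refine measure_mono fun p hp => ?_
        simp only [Set.mem_compl_iff, Set.mem_prod, not_and_or] at hp
        exact hp
    _ ≤ _ := measure_union_le _ _
    _ ≤ ε / 2 + ε / 2 := by
        gcongr
        · rw [← Measure.fst_apply hK.measurableSet.compl, hP.1]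
          exact hμ _ rfl
        · rw [← Measure.snd_apply hL.measurableSet.compl, hP.2]
          exact hν _ rfl
    _ = ε := ENNReal.add_halves ε

end Compactness

/-! ### Quadratic identities in `L²`. -/

section SquareIntegrable

variable {α : Type*} [MeasurableSpace α] {E : Type*} [NormedAddCommGroup E]

lemma eLpNorm_two_sq (f : α → E) (μ : Measure α) :
    eLpNorm f 2 μ ^ 2 = ∫⁻ x, ‖f x‖ₑ ^ 2 ∂μ := by
  have := eLpNorm_nnreal_pow_eq_lintegral (f := f) (μ := μ) (p := 2) two_ne_zero
  simpa [ENNReal.rpow_ofNat] using this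

lemma enorm_sq_eq_ofReal (x : E) : ‖x‖ₑ ^ 2 = ENNReal.ofReal (‖x‖ ^ 2) := by
  rw [ENNReal.ofReal_pow (norm_nonneg _), ofReal_norm]

lemma lintegral_enorm_sq_eq_ofReal {f : α → E} {μ : Measure α} (hf : MemLp f 2 μ) :
    ∫⁻ x, ‖f x‖ₑ ^ 2 ∂μ = ENNReal.ofReal (∫ x, ‖f x‖ ^ 2 ∂μ) := by
  simp_rw [enorm_sq_eq_ofReal]
  rw [ofReal_integral_eq_lintegral_ofReal
    ((memLp_two_iff_integrable_sq_norm hf.aestronglyMeasurable).1 hf)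
    (ae_of_all _ fun x => by positivity)]

lemma integral_norm_sq_nonneg (f : α → E) (μ : Measure α) : 0 ≤ ∫ x, ‖f x‖ ^ 2 ∂μ :=
  integral_nonneg fun x => by positivity

variable [InnerProductSpace ℝ E]

lemma MemLp.integrable_real_inner {f g : α → E} {μ : Measure α} (hf : MemLp f 2 μ)
    (hg : MemLp g 2 μ) : Integrable (fun x => ⟪f x, g x⟫) μ := by
  refine (L2.integrable_inner (𝕜 := ℝ) (hf.toLp f) (hg.toLp g)).congr ?_
  filter_upwards [hf.coeFn_toLp, hg.coeFn_toLp] with x h1 h2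
  rw [h1, h2]

lemma integral_norm_sub_sq {f g : α → E} {μ : Measure α} (hf : MemLp f 2 μ) (hg : MemLp g 2 μ) :
    ∫ x, ‖f x - g x‖ ^ 2 ∂μ =
      ∫ x, ‖f x‖ ^ 2 ∂μ - 2 * ∫ x, ⟪f x, g x⟫ ∂μ + ∫ x, ‖g x‖ ^ 2 ∂μ := by
  have h1 := (memLp_two_iff_integrable_sq_norm hf.aestronglyMeasurable).1 hf
  have h2 := (memLp_two_iff_integrable_sq_norm hg.aestronglyMeasurable).1 hg
  have h3 := (MemLp.integrable_real_inner hf hg).const_mul 2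
  simp_rw [norm_sub_sq_real]
  rw [integral_add (f := fun x => ‖f x‖ ^ 2 - 2 * ⟪f x, g x⟫) (h1.sub h3) h2, integral_sub h1 h3, integral_const_mul]

/-- When the second moments agree, comparing quadratic costs amounts to comparing correlations. -/
lemma lintegral_enorm_sub_sq_le_iff {β : Type*} [MeasurableSpace β] {μ : Measure α}
    {μ' : Measure β} {f g : α → E} {f' g' : β → E} (hf : MemLp f 2 μ) (hg : MemLp g 2 μ)
    (hf' : MemLp f' 2 μ') (hg' : MemLp g' 2 μ')
    (hff' : ∫⁻ x, ‖f x‖ₑ ^ 2 ∂μ = ∫⁻ x, ‖f' x‖ₑ ^ 2 ∂μ')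
    (hgg' : ∫⁻ x, ‖g x‖ₑ ^ 2 ∂μ = ∫⁻ x, ‖g' x‖ₑ ^ 2 ∂μ') :
    ∫⁻ x, ‖f x - g x‖ₑ ^ 2 ∂μ ≤ ∫⁻ x, ‖f' x - g' x‖ₑ ^ 2 ∂μ' ↔
      ∫ x, ⟪f' x, g' x⟫ ∂μ' ≤ ∫ x, ⟪f x, g x⟫ ∂μ := by
  rw [lintegral_enorm_sq_eq_ofReal hf, lintegral_enorm_sq_eq_ofReal hf',
    ENNReal.ofReal_eq_ofReal_iff (integral_norm_sq_nonneg _ _) (integral_norm_sq_nonneg _ _)] at hff'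
  rw [lintegral_enorm_sq_eq_ofReal hg, lintegral_enorm_sq_eq_ofReal hg',
    ENNReal.ofReal_eq_ofReal_iff (integral_norm_sq_nonneg _ _) (integral_norm_sq_nonneg _ _)] at hgg'
  rw [lintegral_enorm_sq_eq_ofReal (f := fun x => f x - g x) (hf.sub hg),
    lintegral_enorm_sq_eq_ofReal (f := fun x => f' x - g' x) (hf'.sub hg'),
    ENNReal.ofReal_le_ofReal_iff (integral_norm_sq_nonneg _ _), integral_norm_sub_sq hf hg,
    integral_norm_sub_sq hf' hg']
  constructor <;> intro h <;> linarith

/-- After expansion the left side minus the right side is `2⟪a - c, b - d⟫`: exchanging the targets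
of a non-monotone pair strictly lowers the cost. -/
lemma enorm_sub_sq_add_enorm_sub_sq_lt {a b c d : E} (h : ⟪a - c, b - d⟫ < 0) :
    ‖a - d‖ₑ ^ 2 + ‖c - b‖ₑ ^ 2 < ‖a - b‖ₑ ^ 2 + ‖c - d‖ₑ ^ 2 := by
  simp_rw [enorm_sq_eq_ofReal]
  rw [← ENNReal.ofReal_add (by positivity) (by positivity),
    ← ENNReal.ofReal_add (by positivity) (by positivity)]
  have key : ‖a - d‖ ^ 2 + ‖c - b‖ ^ 2 < ‖a - b‖ ^ 2 + ‖c - d‖ ^ 2 := by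
    simp_rw [norm_sub_sq_real]
    rw [inner_sub_left, inner_sub_right, inner_sub_right] at h
    linarith
  exact (ENNReal.ofReal_lt_ofReal_iff (by nlinarith [sq_nonneg ‖a - d‖, sq_nonneg ‖c - b‖])).2 key

lemma enorm_sub_sq_add_enorm_add_sq (x y : E) :
    ‖x - y‖ₑ ^ 2 + ‖x + y‖ₑ ^ 2 = 2 * ‖x‖ₑ ^ 2 + 2 * ‖y‖ₑ ^ 2 := by
  simp_rw [enorm_sq_eq_ofReal]
  rw [← ENNReal.ofReal_ofNat, ← ENNReal.ofReal_mul (by norm_num),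
    ← ENNReal.ofReal_mul (by norm_num), ← ENNReal.ofReal_add (by positivity) (by positivity),
    ← ENNReal.ofReal_add (by positivity) (by positivity)]
  congr 1
  have := parallelogram_law_with_norm ℝ x y
  nlinarith

end SquareIntegrable

/-! ### Closed monotone graphs are single-valued almost everywhere. -/

section MonotoneGraph

variable {E : Type*} [NormedAddCommGroup E] [InnerProductSpace ℝ E]

/-- A monotone relation on an inner product space. -/
def IsMonotoneGraph (Γ : Set (E × E)) : Prop :=
  ∀ p ∈ Γ, ∀ q ∈ Γ, 0 ≤ ⟪p.1 - q.1, p.2 - q.2⟫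

variable [FiniteDimensional ℝ E] [MeasurableSpace E] [BorelSpace E]

lemma measurableSet_of_isSigmaCompact {X : Type*} [TopologicalSpace X] [T2Space X]
    [MeasurableSpace X] [OpensMeasurableSpace X] {s : Set X} (hs : IsSigmaCompact s) :
    MeasurableSet s := by
  obtain ⟨K, hK, rfl⟩ := hs
  exact MeasurableSet.iUnion fun i => (hK i).measurableSet

/-- The points over which a monotone graph jumps across `[a, b]` in a given direction are
negligible: each line in that direction contains at most one of them. -/
lemma IsMonotoneGraph.ae_not_jump {Γ : Set (E × E)} (hΓ : IsMonotoneGraph Γ) (hc : IsClosed Γ)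
    (μ : Measure E) [μ.IsAddHaarMeasure] (v : E) {a b : ℝ} (hab : a < b) :
    ∀ᵐ x ∂μ, ¬ ∃ y z, (x, y) ∈ Γ ∧ (x, z) ∈ Γ ∧ ⟪v, y⟫ ≤ a ∧ b ≤ ⟪v, z⟫ := by
  set A : Set E := {x | ∃ y z, (x, y) ∈ Γ ∧ (x, z) ∈ Γ ∧ ⟪v, y⟫ ≤ a ∧ b ≤ ⟪v, z⟫} with hA
  -- `A` is a projection of a closed subset of a σ-compact space, hence itself σ-compact.
  have hAm : MeasurableSet A := by
    have hcl : IsClosed {q : E × E × E | (q.1, q.2.1) ∈ Γ ∧ (q.1, q.2.2) ∈ Γ ∧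
        ⟪v, q.2.1⟫ ≤ a ∧ b ≤ ⟪v, q.2.2⟫} := by
      have h1 : Continuous fun q : E × E × E => (q.1, q.2.1) := by fun_prop
      have h2 : Continuous fun q : E × E × E => (q.1, q.2.2) := by fun_prop
      have h3 : Continuous fun q : E × E × E => ⟪v, q.2.1⟫ := by fun_prop
      have h4 : Continuous fun q : E × E × E => ⟪v, q.2.2⟫ := by fun_prop
      exact (hc.preimage h1).inter ((hc.preimage h2).inter
        ((isClosed_le h3 continuous_const).inter (isClosed_le continuous_const h4)))
    have hσ := (isSigmaCompact_univ (X := E × E × E)).of_isClosed_subset hcl (Set.subset_univ _)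
    convert measurableSet_of_isSigmaCompact (hσ.image continuous_fst)
    ext x
    simp [hA]
  -- Fubini: it suffices that `A` meets every line in direction `v` in a null set.
  refine ae_mem_of_ae_add_linearMap_mem (LinearMap.toSpanSingleton ℝ E v) (volume : Measure ℝ) μ
    (s := Aᶜ) hAm.compl fun y => ?_
  have hsub : Set.Subsingleton {t : ℝ | y + t • v ∈ A} := by
    intro s hs t ht
    by_contra hne
    wlog hst : s < t generalizing s t
    · exact this ht hs (Ne.symm hne) (lt_of_le_of_ne (not_lt.1 hst) (Ne.symm hne))
    obtain ⟨-, z, -, hz, -, hbz⟩ := hs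
    obtain ⟨w, -, hw, -, hwa, -⟩ := ht
    -- Monotonicity gives `0 ≤ (t - s) * (⟪v, w⟫ - ⟪v, z⟫)`, while `⟪v, w⟫ ≤ a < b ≤ ⟪v, z⟫`.
    have := hΓ _ hw _ hz
    simp only [add_sub_add_left_eq_sub, ← sub_smul, real_inner_smul_left, inner_sub_right] at this
    nlinarith
  have := hsub.countable.ae_notMem (volume : Measure ℝ)
  filter_upwards [this] with t ht
  simpa using ht

/-- A closed monotone graph is single-valued almost everywhere. -/
lemma IsMonotoneGraph.ae_subsingleton {Γ : Set (E × E)} (hΓ : IsMonotoneGraph Γ)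
    (hc : IsClosed Γ) (μ : Measure E) [μ.IsAddHaarMeasure] :
    ∀ᵐ x ∂μ, ∀ y z, (x, y) ∈ Γ → (x, z) ∈ Γ → y = z := by
  set e := stdOrthonormalBasis ℝ E
  have h : ∀ᵐ x ∂μ, ∀ (i : Fin (Module.finrank ℝ E)) (a b : ℚ), a < b →
      ¬ ∃ y z, (x, y) ∈ Γ ∧ (x, z) ∈ Γ ∧ ⟪e i, y⟫ ≤ (a : ℝ) ∧ (b : ℝ) ≤ ⟪e i, z⟫ := by
    simp only [ae_all_iff]
    intro i a b hab
    exact hΓ.ae_not_jump hc μ (e i) (by exact_mod_cast hab)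
  filter_upwards [h] with x hx y z hy hz
  have hle : ∀ i, ∀ y z, (x, y) ∈ Γ → (x, z) ∈ Γ → ⟪e i, z⟫ ≤ ⟪e i, y⟫ := by
    intro i y z hy hz
    by_contra! hlt
    obtain ⟨a, ha1, ha2⟩ := exists_rat_btwn hlt
    obtain ⟨b, hb1, hb2⟩ := exists_rat_btwn ha2
    exact hx i a b (by exact_mod_cast hb1) ⟨y, z, hy, hz, ha1.le, hb2.le⟩
  refine InnerProductSpace.ext_inner_left_basis e.toBasis fun i => ?_
  simpa using le_antisymm (hle i z y hz hy) (hle i y z hy hz)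

/-- A plan concentrated on a closed monotone graph, with absolutely continuous first marginal, is
induced by a map. -/
lemma IsMonotoneGraph.exists_map {Γ : Set (E × E)} (hΓ : IsMonotoneGraph Γ)
    (hc : IsClosed Γ) {π : Measure (E × E)} [IsProbabilityMeasure π] (hπ : Γ ∈ ae π)
    {lam : Measure E} [lam.IsAddHaarMeasure] (hac : π.fst ≪ lam) :
    ∃ T : E → E, Measurable T ∧ π = π.fst.map fun x => (x, T x) := by
  set κ := π.condKernel
  -- The conditional laws turn out to be Dirac masses a.e.; taking their barycentre makes `T`
  -- measurable without a selection theorem.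
  set T : E → E := fun x => ∫ y, y ∂κ x with hT
  have hTm : Measurable T :=
    (StronglyMeasurable.integral_kernel_prod_right (κ := κ) (f := fun _ y => y)
      measurable_snd.stronglyMeasurable).measurable
  have hset : MeasurableSet {p : E × E | p.2 = T p.1} :=
    measurableSet_eq_fun measurable_snd (hTm.comp measurable_fst)
  have hdis : π.fst ⊗ₘ κ = π := Measure.disintegrate π κ
  have hgraph : ∀ᵐ p ∂π, p.2 = T p.1 := by
    have hπ' : ∀ᵐ x ∂π.fst, ∀ᵐ y ∂κ x, (x, y) ∈ Γ :=
      (Measure.ae_compProd_iff (p := (· ∈ Γ)) hc.measurableSet).1 (by rw [hdis]; exact hπ)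
    rw [← hdis, Measure.ae_compProd_iff hset]
    filter_upwards [hπ', hac.ae_le (hΓ.ae_subsingleton hc lam)] with x hx hs
    obtain ⟨y₀, hy₀⟩ := hx.exists
    have hy : ∀ᵐ y ∂κ x, y = y₀ := hx.mono fun y hy => hs _ _ hy hy₀
    have : T x = y₀ := by
      rw [hT]
      simp only
      rw [integral_congr_ae hy]
      simp
    filter_upwards [hy] with y h
    rw [h, this]
  refine ⟨T, hTm, ?_⟩
  conv_lhs => rw [← Measure.map_id (μ := π)]
  rw [Measure.fst, Measure.map_map (measurable_id'.prodMk hTm) measurable_fst]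
  refine Measure.map_congr ?_
  filter_upwards [hgraph] with p hp
  exact Prod.ext rfl hp

end MonotoneGraph

/-! ### Integrals against couplings and the quadratic cost. -/

section TransportCost

variable {X Y E : Type*} [MeasurableSpace X] [MeasurableSpace Y] [NormedAddCommGroup E]

lemma lintegral_comp_fst_of_mem_couplings {μ : Measure X} {ν : Measure Y} {π : Measure (X × Y)}
    (hπ : π ∈ couplings μ ν) {f : X → ℝ≥0∞} (hf : AEMeasurable f μ) :
    ∫⁻ p, f p.1 ∂π = ∫⁻ x, f x ∂μ := by
  have := hπ.1
  rw [← this] at hf ⊢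
  exact (lintegral_map' hf measurable_fst.aemeasurable).symm

lemma lintegral_comp_snd_of_mem_couplings {μ : Measure X} {ν : Measure Y} {π : Measure (X × Y)}
    (hπ : π ∈ couplings μ ν) {f : Y → ℝ≥0∞} (hf : AEMeasurable f ν) :
    ∫⁻ p, f p.2 ∂π = ∫⁻ x, f x ∂ν := by
  have := hπ.2
  rw [← this] at hf ⊢
  exact (lintegral_map' hf measurable_snd.aemeasurable).symm

lemma memLp_comp_fst_of_mem_couplings {μ : Measure X} {ν : Measure Y} {π : Measure (X × Y)}
    (hπ : π ∈ couplings μ ν) {f : X → E} (hf : MemLp f 2 μ) : MemLp (fun p => f p.1) 2 π := by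
  have := hπ.1
  rw [← this] at hf
  exact hf.comp_of_map measurable_fst.aemeasurable

lemma memLp_comp_snd_of_mem_couplings {μ : Measure X} {ν : Measure Y} {π : Measure (X × Y)}
    (hπ : π ∈ couplings μ ν) {f : Y → E} (hf : MemLp f 2 ν) : MemLp (fun p => f p.2) 2 π := by
  have := hπ.2
  rw [← this] at hf
  exact hf.comp_of_map measurable_snd.aemeasurable

variable [MeasurableSpace E]

/-- The quadratic cost of a transport plan. -/
noncomputable def transportCost (π : Measure (E × E)) : ℝ≥0∞ := ∫⁻ p, ‖p.1 - p.2‖ₑ ^ 2 ∂π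

/-- Optimality of a transport plan for the quadratic cost. -/
def IsOptimalPlan (μ ν : Measure E) (π : Measure (E × E)) : Prop :=
  π ∈ couplings μ ν ∧ ∀ π' ∈ couplings μ ν, transportCost π ≤ transportCost π'

lemma transportCost_eq_eLpNorm_sq (π : Measure (E × E)) :
    transportCost π = eLpNorm (fun p => p.1 - p.2) 2 π ^ 2 :=
  (eLpNorm_two_sq _ _).symm

lemma transportCost_ne_top {μ ν : Measure E} (hμ : MemLp id 2 μ) (hν : MemLp id 2 ν)
    {π : Measure (E × E)} (hπ : π ∈ couplings μ ν) : transportCost π ≠ ∞ := by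
  rw [transportCost_eq_eLpNorm_sq]
  exact ENNReal.pow_ne_top
    ((memLp_comp_fst_of_mem_couplings hπ hμ).sub (memLp_comp_snd_of_mem_couplings hπ hν)).2.ne

end TransportCost

/-! ### Optimal plans: existence, monotonicity, uniqueness. -/

section OptimalPlan

variable {E : Type*} [NormedAddCommGroup E] [InnerProductSpace ℝ E] [FiniteDimensional ℝ E]
  [MeasurableSpace E] [BorelSpace E]

lemma transportCost_map_graph {μ : Measure E} {T : E → E} (hT : AEMeasurable T μ) :
    transportCost (μ.map fun x => (x, T x)) = ∫⁻ x, ‖T x - x‖ₑ ^ 2 ∂μ := by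
  rw [transportCost, lintegral_map' (by fun_prop) (aemeasurable_id'.prodMk hT)]
  simp_rw [← enorm_neg (T _ - _), neg_sub]

lemma exists_isMinOn_lintegral_of_isCompact {Ω : Type*} [MeasurableSpace Ω] [TopologicalSpace Ω]
    [OpensMeasurableSpace Ω] {K : Set (ProbabilityMeasure Ω)} (hK : IsCompact K)
    (hne : K.Nonempty) {f : Ω → ℝ≥0} (hf : Continuous f) :
    ∃ P ∈ K, ∀ Q ∈ K, ∫⁻ x, f x ∂(P : Measure Ω) ≤ ∫⁻ x, f x ∂(Q : Measure Ω) :=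
  ((lowerSemicontinuous_lintegral hf).lowerSemicontinuousOn K).exists_isMinOn hne hK

lemma exists_isOptimalPlan (μ ν : Measure E) [IsProbabilityMeasure μ] [IsProbabilityMeasure ν] :
    ∃ π, IsOptimalPlan μ ν π := by
  have hne : {P : ProbabilityMeasure (E × E) | (P : Measure (E × E)) ∈ couplings μ ν}.Nonempty :=
    ⟨⟨μ.prod ν, inferInstance⟩, Measure.fst_prod, Measure.snd_prod⟩
  obtain ⟨P, hP, hmin⟩ := exists_isMinOn_lintegral_of_isCompact (isCompact_couplings μ ν) hne
    (f := fun p => ‖p.1 - p.2‖₊ ^ 2) (by fun_prop)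
  refine ⟨P, hP, fun π' hπ' => ?_⟩
  simpa [transportCost, enorm_eq_nnnorm] using
    hmin ⟨π', isProbabilityMeasure_of_mem_couplings hπ'⟩ hπ'

/-- Exchanging the targets of two independent draws from an optimal plan cannot pay off, so such
draws are monotone almost surely. -/
lemma IsOptimalPlan.ae_prod_monotone {μ ν : Measure E} [IsProbabilityMeasure μ]
    (hμ : MemLp id 2 μ) (hν : MemLp id 2 ν) {π : Measure (E × E)} (hπ : IsOptimalPlan μ ν π) :
    ∀ᵐ r ∂π.prod π, 0 ≤ ⟪r.1.1 - r.2.1, r.1.2 - r.2.2⟫ := by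
  have := isProbabilityMeasure_of_mem_couplings hπ.1
  set B : Set ((E × E) × (E × E)) := {r | ⟪r.1.1 - r.2.1, r.1.2 - r.2.2⟫ < 0} with hB
  have hBm : MeasurableSet B :=
    measurableSet_lt (by fun_prop) measurable_const
  have hBsymm : ∀ r : (E × E) × (E × E), r.swap ∈ B ↔ r ∈ B := by
    intro r
    simp only [hB, Set.mem_ofPred_eq, Prod.fst_swap, Prod.snd_swap]
    rw [← neg_sub r.1.1, ← neg_sub r.1.2, inner_neg_neg]
  classical
  -- The competitor gives the first point the second draw's target precisely on the bad set `B`.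
  set t : (E × E) × (E × E) → E := fun r => if r ∈ B then r.2.2 else r.1.2 with ht
  have htm : Measurable t := Measurable.ite hBm (by fun_prop) (by fun_prop)
  have hswap := Measure.measurePreserving_swap (μ := π) (ν := π)
  have hfst : (π.prod π).map Prod.fst = π := by
    have := Measure.fst_prod (μ := π) (ν := π); exact this
  set Φ : (E × E) × (E × E) → E × E := fun r => (r.1.1, t r) with hΦ
  have hΦm : Measurable Φ := Measurable.prodMk (by fun_prop) htm
  have hcoup : (π.prod π).map Φ ∈ couplings μ ν := by
    constructor
    · rw [Measure.fst, Measure.map_map measurable_fst hΦm, ← hπ.1.1, Measure.fst]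
      conv_rhs => rw [← hfst, Measure.map_map measurable_fst measurable_fst]
      rfl
    · rw [Measure.snd, Measure.map_map measurable_snd hΦm, ← hπ.1.2, Measure.snd]
      conv_rhs => rw [← hfst, Measure.map_map measurable_snd measurable_fst]
      refine Measure.ext_of_lintegral _ fun f hf => ?_
      rw [lintegral_map hf (measurable_snd.comp hΦm),
        lintegral_map hf (measurable_snd.comp measurable_fst),
        ← lintegral_add_compl _ hBm,
        ← lintegral_add_compl (fun r : (E × E) × (E × E) => f ((Prod.snd ∘ Prod.fst) r)) hBm]
      congr 1
      -- On `B` the two targets have the same law, since both `B` and `π.prod π` are invariant under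
      -- the swap; so the second marginal is still `ν`.
      · rw [← hswap.setLIntegral_comp_preimage hBm
          (f := fun r => f ((Prod.snd ∘ Prod.fst) r)) (by fun_prop)]
        rw [show Prod.swap ⁻¹' B = B from Set.ext hBsymm]
        refine setLIntegral_congr_fun hBm fun r hr => ?_
        simp [hΦ, ht, hr]
      · refine setLIntegral_congr_fun hBm.compl fun r hr => ?_
        have : r ∉ B := hr
        simp [hΦ, ht, this]
  set c : E × E → ℝ≥0∞ := fun p => ‖p.1 - p.2‖ₑ ^ 2 with hc
  have hcm : Measurable c := by fun_prop
  have hcost1 : transportCost π = ∫⁻ r, c r.1 ∂π.prod π := by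
    conv_lhs => rw [← hfst]
    exact lintegral_map hcm measurable_fst
  have hcost2 : transportCost π = ∫⁻ r, c r.2 ∂π.prod π := by
    rw [hcost1, ← hswap.lintegral_comp (f := fun r => c r.1) (by fun_prop)]
    rfl
  have hcost3 : transportCost ((π.prod π).map Φ) = ∫⁻ r, c (Φ r) ∂π.prod π :=
    lintegral_map hcm hΦm
  have hcost4 : transportCost ((π.prod π).map Φ) = ∫⁻ r, c (Φ r.swap) ∂π.prod π := by
    rw [hcost3, ← hswap.lintegral_comp (f := fun r => c (Φ r)) (hcm.comp hΦm)]
  have hopt := hπ.2 _ hcoup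
  have hlt : ∀ r ∈ B, c (Φ r) + c (Φ r.swap) < c r.1 + c r.2 := by
    intro r hr
    have hr' := (hBsymm r).2 hr
    simp only [hΦ, ht, hr, hr', if_true, hc, Prod.fst_swap, Prod.snd_swap]
    exact enorm_sub_sq_add_enorm_sub_sq_lt hr
  have heq : ∀ r ∉ B, c (Φ r) + c (Φ r.swap) = c r.1 + c r.2 := by
    intro r hr
    have hr' : r.swap ∉ B := fun h => hr ((hBsymm r).1 h)
    simp [hΦ, ht, hr, hr', hc]
  have hle : ∀ r, c (Φ r) + c (Φ r.swap) ≤ c r.1 + c r.2 := fun r => by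
    by_cases hr : r ∈ B
    exacts [(hlt r hr).le, (heq r hr).le]
  have hcΦ : Measurable fun r => c (Φ r) := hcm.comp hΦm
  have hfin := transportCost_ne_top hμ hν hcoup
  -- Symmetrized over the swap, the competitor costs pointwise no more than the original, strictly
  -- less on `B`. Optimality gives the reverse inequality of the finite integrals, so equality holds
  -- a.e. and `B` is null.
  have hae := ae_eq_of_ae_le_of_lintegral_le (μ := π.prod π) (ae_of_all _ hle) (by
    rw [lintegral_add_left hcΦ, ← hcost3, ← hcost4]
    exact ENNReal.add_ne_top.2 ⟨hfin, hfin⟩) (by fun_prop) (by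
    rw [lintegral_add_left hcΦ, ← hcost3, ← hcost4, lintegral_add_left (by fun_prop), ← hcost1,
      ← hcost2]
    gcongr)
  filter_upwards [hae] with r hr
  by_contra! hneg
  exact (hlt r hneg).ne hr

/-- Non-monotone pairs form an open set, and a product of neighbourhoods of two support points has
positive `π.prod π` measure, so the almost sure statement becomes a pointwise one. -/
lemma IsOptimalPlan.isMonotoneGraph_support {μ ν : Measure E} [IsProbabilityMeasure μ]
    (hμ : MemLp id 2 μ) (hν : MemLp id 2 ν) {π : Measure (E × E)} (hπ : IsOptimalPlan μ ν π) :
    IsMonotoneGraph π.support := by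
  have := isProbabilityMeasure_of_mem_couplings hπ.1
  intro p hp q hq
  by_contra! hneg
  have hopen : IsOpen {r : (E × E) × (E × E) | ⟪r.1.1 - r.2.1, r.1.2 - r.2.2⟫ < 0} :=
    isOpen_lt (by fun_prop) continuous_const
  obtain ⟨U, V, hU, hV, hpU, hqV, hUV⟩ := isOpen_prod_iff.1 hopen p q hneg
  have hzero : (π.prod π) (U ×ˢ V) = 0 := by
    refine measure_mono_null hUV ?_
    have := hπ.ae_prod_monotone hμ hν
    rw [ae_iff] at this
    simpa using this
  rw [Measure.prod_prod, mul_eq_zero] at hzero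
  rcases hzero with h | h
  · exact ((Measure.mem_support_iff_forall p).1 hp U (hU.mem_nhds hpU)).ne' h
  · exact ((Measure.mem_support_iff_forall q).1 hq V (hV.mem_nhds hqV)).ne' h

lemma IsOptimalPlan.exists_map {μ ν lam : Measure E} [IsProbabilityMeasure μ]
    [lam.IsAddHaarMeasure] (hac : μ ≪ lam) (hμ : MemLp id 2 μ) (hν : MemLp id 2 ν)
    {π : Measure (E × E)} (hπ : IsOptimalPlan μ ν π) :
    ∃ T : E → E, Measurable T ∧ π = μ.map fun x => (x, T x) := by
  have := isProbabilityMeasure_of_mem_couplings hπ.1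
  have h := (hπ.isMonotoneGraph_support hμ hν).exists_map Measure.isClosed_support
    Measure.support_mem_ae (lam := lam) (by rw [hπ.1.1]; exact hac)
  rwa [hπ.1.1] at h

lemma ae_eq_of_map_graph_eq {μ : Measure E} {S T : E → E} (hS : AEMeasurable S μ)
    (hT : Measurable T) (h : μ.map (fun x => (x, S x)) = μ.map fun x => (x, T x)) :
    S =ᵐ[μ] T := by
  have hset : MeasurableSet {p : E × E | p.2 = T p.1} :=
    measurableSet_eq_fun measurable_snd (hT.comp measurable_fst)
  have h1 : ∀ᵐ p ∂μ.map (fun x => (x, S x)), p.2 = T p.1 := by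
    rw [h, ae_map_iff (by fun_prop) hset]
    simp
  exact ae_of_ae_map (aemeasurable_id'.prodMk hS) h1

/-- The average of two optimal plans is optimal, hence induced by a map, so they coincide. -/
lemma IsOptimalPlan.eq {μ ν lam : Measure E} [IsProbabilityMeasure μ]
    [lam.IsAddHaarMeasure] (hac : μ ≪ lam) (hμ : MemLp id 2 μ) (hν : MemLp id 2 ν)
    {π₁ π₂ : Measure (E × E)} (h₁ : IsOptimalPlan μ ν π₁) (h₂ : IsOptimalPlan μ ν π₂) :
    π₁ = π₂ := by
  have hhalf : (2⁻¹ : ℝ≥0∞) + 2⁻¹ = 1 := ENNReal.inv_two_add_inv_two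
  have hcost : transportCost π₂ = transportCost π₁ :=
    le_antisymm (h₂.2 _ h₁.1) (h₁.2 _ h₂.1)
  set π := (2⁻¹ : ℝ≥0∞) • (π₁ + π₂) with hπ
  have hopt : IsOptimalPlan μ ν π := by
    refine ⟨⟨?_, ?_⟩, fun π' hπ' => ?_⟩
    · rw [Measure.fst, hπ, Measure.map_smul, Measure.map_add _ _ measurable_fst, ← Measure.fst,
        ← Measure.fst, h₁.1.1, h₂.1.1, smul_add, ← add_smul, hhalf, one_smul]
    · rw [Measure.snd, hπ, Measure.map_smul, Measure.map_add _ _ measurable_snd, ← Measure.snd,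
        ← Measure.snd, h₁.1.2, h₂.1.2, smul_add, ← add_smul, hhalf, one_smul]
    · refine le_trans (le_of_eq ?_) (h₁.2 _ hπ')
      rw [transportCost, hπ, lintegral_smul_measure, lintegral_add_measure, ← transportCost,
        ← transportCost, hcost, smul_eq_mul, mul_add, ← add_mul, hhalf, one_mul]
  obtain ⟨T, hT, hTπ⟩ := hopt.exists_map hac hμ hν
  obtain ⟨T₁, hT₁, hTπ₁⟩ := h₁.exists_map hac hμ hν
  obtain ⟨T₂, hT₂, hTπ₂⟩ := h₂.exists_map hac hμ hν
  have hset : MeasurableSet {p : E × E | p.2 = T p.1} :=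
    measurableSet_eq_fun measurable_snd (hT.comp measurable_fst)
  have hgraph : ∀ᵐ p ∂π, p.2 = T p.1 := by
    rw [hTπ, ae_map_iff (by fun_prop) hset]
    simp
  have hac₁ : π₁ + π₂ ≪ π := Measure.AbsolutelyContinuous.smul_right le_rfl.absolutelyContinuous
    (by simp)
  have hgraph' : ∀ᵐ p ∂(π₁ + π₂), p.2 = T p.1 := hac₁.ae_le hgraph
  rw [ae_add_measure_iff] at hgraph'
  obtain ⟨hg₁, hg₂⟩ := hgraph'
  have e₁ : T₁ =ᵐ[μ] T := by
    rw [hTπ₁] at hg₁; exact ae_of_ae_map (by fun_prop) hg₁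
  have e₂ : T₂ =ᵐ[μ] T := by
    rw [hTπ₂] at hg₂; exact ae_of_ae_map (by fun_prop) hg₂
  rw [hTπ₁, hTπ₂]
  refine Measure.map_congr ?_
  filter_upwards [e₁, e₂] with x h1 h2
  rw [h1, h2]

end OptimalPlan

/-! ### Existence of optimal maps and stability of nearly optimal plans. -/

section Stability

variable {E : Type*} [NormedAddCommGroup E] [InnerProductSpace ℝ E] [FiniteDimensional ℝ E]
  [MeasurableSpace E] [BorelSpace E]

/-- **Brenier's theorem**, without potentials: for an absolutely continuous source, an optimal
plan is induced by a map. -/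
lemma exists_measurable_isOptimalPlan_graph {μ lam : Measure E} [IsProbabilityMeasure μ]
    [lam.IsAddHaarMeasure] (hac : μ ≪ lam) (ν : Measure E) [IsProbabilityMeasure ν]
    (hμ : MemLp id 2 μ) (hν : MemLp id 2 ν) :
    ∃ T : E → E, Measurable T ∧ μ.map T = ν ∧ IsOptimalPlan μ ν (μ.map fun x => (x, T x)) := by
  obtain ⟨π, hπ⟩ := exists_isOptimalPlan μ ν
  obtain ⟨T, hT, rfl⟩ := hπ.exists_map hac hμ hν
  refine ⟨T, hT, ?_, hπ⟩
  rw [← hπ.1.2, Measure.snd, Measure.map_map measurable_snd (by fun_prop)]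
  rfl

lemma lintegral_enorm_snd_sub_sq_add {μ ν : Measure E} {π : Measure (E × E)}
    (hπ : π ∈ couplings μ ν) {h : E → E} (hh : Measurable h) :
    ∫⁻ p, ‖p.2 - h p.1‖ₑ ^ 2 ∂π + ∫⁻ p, ‖p.2 + h p.1‖ₑ ^ 2 ∂π =
      2 * ∫⁻ y, ‖y‖ₑ ^ 2 ∂ν + 2 * ∫⁻ x, ‖h x‖ₑ ^ 2 ∂μ := by
  rw [← lintegral_add_left (by fun_prop)]
  simp_rw [enorm_sub_sq_add_enorm_add_sq]
  rw [lintegral_add_left (by fun_prop), lintegral_const_mul _ (by fun_prop),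
    lintegral_const_mul _ (by fun_prop),
    lintegral_comp_snd_of_mem_couplings hπ (f := fun y => ‖y‖ₑ ^ 2) (by fun_prop),
    lintegral_comp_fst_of_mem_couplings hπ (f := fun x => ‖h x‖ₑ ^ 2) (by fun_prop)]

/-- Stability of the optimal map: nearly optimal plans are nearly induced by it. -/
lemma IsOptimalPlan.exists_forall_eLpNorm_le {μ ν lam : Measure E} [IsProbabilityMeasure μ]
    [IsProbabilityMeasure ν] [lam.IsAddHaarMeasure] (hac : μ ≪ lam) (hμ : MemLp id 2 μ)
    (hν : MemLp id 2 ν) {T : E → E} (hT : Measurable T) (hTν : μ.map T = ν)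
    (hopt : IsOptimalPlan μ ν (μ.map fun x => (x, T x))) {ε : ℝ≥0∞} (hε : 0 < ε) :
    ∃ δ : ℝ≥0∞, 0 < δ ∧ ∀ π ∈ couplings μ ν,
      eLpNorm (fun p => p.1 - p.2) 2 π < eLpNorm (fun x => x - T x) 2 μ + δ →
        eLpNorm (fun p => p.2 - T p.1) 2 π ≤ ε := by
  wlog hε1 : ε ≤ 1 generalizing ε
  · obtain ⟨δ, hδ, h⟩ := this one_pos le_rfl
    exact ⟨δ, hδ, fun π hπ hlt => (h π hπ hlt).trans (not_le.1 hε1).le⟩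
  set π₀ := μ.map fun x => (x, T x) with hπ₀
  have hTL : MemLp T 2 μ := by
    rw [← hTν] at hν
    exact hν.comp_of_map hT.aemeasurable
  set r := ε / 4 with hr
  have hr0 : r ≠ 0 := (ENNReal.div_pos hε.ne' (by simp)).ne'
  have hrtop : r ≠ ∞ := (ENNReal.div_lt_top (hε1.trans_lt ENNReal.one_lt_top).ne (by simp)).ne
  have h4r : 3 * r + r = ε := by
    calc 3 * r + r = ε / 4 * 4 := by rw [hr]; ring
      _ = ε := ENNReal.div_mul_cancel (by simp) (by simp)
  -- `T` need not be continuous, so semicontinuity is applied with a continuous `h` within `r = ε /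
  -- 4` of it. A plan at distance more than `ε` from `T` is at distance at least `3 * r` from `h`,
  -- whereas the optimal plan is within `r`.
  obtain ⟨h, hTh, hh⟩ := hTL.exists_boundedContinuous_eLpNorm_sub_le (by simp) hr0
  have hhc : Continuous h := h.continuous
  have hhm : Measurable h := hhc.measurable
  set M := 2 * ∫⁻ y, ‖y‖ₑ ^ 2 ∂ν + 2 * ∫⁻ x, ‖h x‖ₑ ^ 2 ∂μ with hM
  have hpar : ∀ π ∈ couplings μ ν,
      ∫⁻ p, ‖p.2 - h p.1‖ₑ ^ 2 ∂π + ∫⁻ p, ‖p.2 + h p.1‖ₑ ^ 2 ∂π = M := fun π hπ =>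
    lintegral_enorm_snd_sub_sq_add hπ hhm
  have hMtop : M ≠ ∞ := by
    rw [hM, ← eLpNorm_two_sq (fun y => y), ← eLpNorm_two_sq (fun x => h x)]
    exact ENNReal.add_ne_top.2 ⟨ENNReal.mul_ne_top (by simp) (ENNReal.pow_ne_top hν.2.ne),
      ENNReal.mul_ne_top (by simp) (ENNReal.pow_ne_top hh.2.ne)⟩
  -- A lower bound on `∫ ‖y - h x‖²` is not closed under lower semicontinuity alone. As the
  -- parallelogram sum is the constant `M`, it becomes an upper bound on `∫ ‖y + h x‖²`, which is
  -- closed.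
  set K : Set (ProbabilityMeasure (E × E)) := {P | (P : Measure (E × E)) ∈ couplings μ ν ∧
    ∫⁻ p, ‖p.2 + h p.1‖ₑ ^ 2 ∂(P : Measure (E × E)) + (3 * r) ^ 2 ≤ M} with hK
  have hKc : IsCompact K := by
    have hlsc := (lowerSemicontinuous_lintegral (Ω := E × E) (f := fun p => ‖p.2 + h p.1‖₊ ^ 2)
      (by fun_prop)).add (lowerSemicontinuous_const (z := (3 * r) ^ 2))
    convert (isCompact_couplings μ ν).inter_right (hlsc.isClosed_preimage M) using 1
    ext P
    simp [hK, enorm_eq_nnnorm]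
  have hmemK : ∀ π (hπ : π ∈ couplings μ ν), ε < eLpNorm (fun p => p.2 - T p.1) 2 π →
      (⟨π, isProbabilityMeasure_of_mem_couplings hπ⟩ : ProbabilityMeasure (E × E)) ∈ K := by
    intro π hπ hlt
    refine ⟨hπ, ?_⟩
    simp only [ProbabilityMeasure.coe_mk]
    rw [← hpar π hπ, add_comm, ← eLpNorm_two_sq (fun p : E × E => p.2 - h p.1)]
    gcongr
    have htri : eLpNorm (fun p => p.2 - T p.1) 2 π ≤
        eLpNorm (fun p => p.2 - h p.1) 2 π + eLpNorm (fun p => T p.1 - h p.1) 2 π := by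
      have : (fun p : E × E => p.2 - T p.1) =
          (fun p => p.2 - h p.1) - fun p => T p.1 - h p.1 := by
        ext p; simp
      rw [this]
      exact eLpNorm_sub_le (by fun_prop) (by fun_prop) (by norm_num)
    have hTh' : eLpNorm (fun p => T p.1 - h p.1) 2 π ≤ r := by
      refine le_trans (le_of_eq ?_) hTh
      rw [← hπ.1, Measure.fst, eLpNorm_map_measure (by fun_prop) (by fun_prop)]
      rfl
    by_contra! hlt'
    have : eLpNorm (fun p => p.2 - T p.1) 2 π ≤ ε := by
      rw [← h4r]
      exact htri.trans (add_le_add hlt'.le hTh')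
    exact absurd hlt (not_lt.2 this)
  have hπ₀K : ∀ P ∈ K, (P : Measure (E × E)) ≠ π₀ := by
    rintro P ⟨hP, hPM⟩ hPπ
    rw [hPπ, ← hpar _ hopt.1, add_comm] at hPM
    have hfin : ∫⁻ p, ‖p.2 + h p.1‖ₑ ^ 2 ∂π₀ ≠ ∞ := by
      have := hpar _ hopt.1
      exact (ENNReal.add_ne_top.1 (this ▸ hMtop)).2
    have h9 := (ENNReal.add_le_add_iff_right hfin).1 hPM
    have hle : ∫⁻ p, ‖p.2 - h p.1‖ₑ ^ 2 ∂π₀ ≤ r ^ 2 := by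
      rw [hπ₀, lintegral_map (by fun_prop) (by fun_prop), ← eLpNorm_two_sq (fun x => T x - h x)]
      gcongr
      exact hTh
    have h3 : 3 * r ≤ r := (ENNReal.pow_le_pow_left_iff two_ne_zero).1 (h9.trans hle)
    have hlt : r < 3 * r := by
      calc r < r + r := ENNReal.lt_add_right hrtop hr0
        _ = 2 * r := (two_mul r).symm
        _ ≤ 3 * r := by gcongr; norm_num
    exact absurd h3 (not_le.2 hlt)
  have hD₀ : eLpNorm (fun p => p.1 - p.2) 2 π₀ = eLpNorm (fun x => x - T x) 2 μ := by
    rw [hπ₀, eLpNorm_map_measure (by fun_prop) (by fun_prop)]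
    rfl
  rcases K.eq_empty_or_nonempty with hKe | hKne
  · refine ⟨1, one_pos, fun π hπ _ => ?_⟩
    by_contra! hlt
    exact (hKe ▸ hmemK π hπ hlt : _ ∈ (∅ : Set (ProbabilityMeasure (E × E))))
  obtain ⟨P, hPK, hPmin⟩ := exists_isMinOn_lintegral_of_isCompact hKc hKne
    (f := fun p => ‖p.1 - p.2‖₊ ^ 2) (by fun_prop)
  -- By uniqueness the minimizer over `K`, which is not `π₀`, is not optimal; the gap in square-root
  -- cost is the required `δ`.
  have hcost : transportCost π₀ < transportCost (P : Measure (E × E)) := by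
    by_contra! hle
    refine hπ₀K P hPK (IsOptimalPlan.eq hac hμ hν ⟨hPK.1, fun π' hπ' => ?_⟩ hopt)
    exact hle.trans (hopt.2 _ hπ')
  rw [transportCost_eq_eLpNorm_sq, transportCost_eq_eLpNorm_sq,
    ENNReal.pow_lt_pow_left_iff two_ne_zero, hD₀] at hcost
  refine ⟨_, tsub_pos_of_lt hcost, fun π hπ hlt => ?_⟩
  rw [add_tsub_cancel_of_le hcost.le] at hlt
  by_contra! hlt'
  have := hPmin _ (hmemK π hπ hlt')
  simp only [ProbabilityMeasure.coe_mk, ENNReal.coe_pow, ← enorm_eq_nnnorm] at this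
  rw [← eLpNorm_two_sq (fun p : E × E => p.1 - p.2),
    ← eLpNorm_two_sq (fun p : E × E => p.1 - p.2),
    ENNReal.pow_le_pow_left_iff two_ne_zero] at this
  exact absurd hlt (not_lt.2 this)

end Stability

/-! ### Optimality as a linear condition on the map. -/

section Correlation

variable {E : Type*} [NormedAddCommGroup E] [InnerProductSpace ℝ E] [MeasurableSpace E]

/-- No self-coupling of `μ` improves the correlation of the identity with `T`. This condition is
linear in `T`. -/
def IsCorrelationMaximal (μ : Measure E) (T : E → E) : Prop :=
  ∀ γ ∈ couplings μ μ, ∫ p, ⟪p.2, T p.1⟫ ∂γ ≤ ∫ x, ⟪x, T x⟫ ∂μ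

lemma ae_comp_fst_of_mem_couplings {X Y : Type*} [MeasurableSpace X] [MeasurableSpace Y]
    {μ : Measure X} {ν : Measure Y} {γ : Measure (X × Y)} (hγ : γ ∈ couplings μ ν) {p : X → Prop}
    (h : ∀ᵐ x ∂μ, p x) : ∀ᵐ q ∂γ, p q.1 := by
  rw [← hγ.1] at h
  exact ae_of_ae_map measurable_fst.aemeasurable h

lemma IsCorrelationMaximal.congr_ae {μ : Measure E} {S T : E → E}
    (hS : IsCorrelationMaximal μ S) (h : S =ᵐ[μ] T) : IsCorrelationMaximal μ T := by
  intro γ hγ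
  have h1 : ∫ p, ⟪p.2, T p.1⟫ ∂γ = ∫ p, ⟪p.2, S p.1⟫ ∂γ :=
    integral_congr_ae ((ae_comp_fst_of_mem_couplings hγ h).mono fun p hp => by
      simp only at hp ⊢; rw [hp])
  have h2 : ∫ x, ⟪x, T x⟫ ∂μ = ∫ x, ⟪x, S x⟫ ∂μ :=
    integral_congr_ae (h.mono fun x hx => by simp only; rw [hx])
  rw [h1, h2]
  exact hS γ hγ

lemma IsCorrelationMaximal.add_smul {μ : Measure E} (hμ : MemLp id 2 μ) {S T : E → E}
    (hSL : MemLp S 2 μ) (hTL : MemLp T 2 μ) (hS : IsCorrelationMaximal μ S)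
    (hT : IsCorrelationMaximal μ T) {a b : ℝ} (ha : 0 ≤ a) (hb : 0 ≤ b) :
    IsCorrelationMaximal μ fun x => a • S x + b • T x := by
  intro γ hγ
  have i1 := MemLp.integrable_real_inner (memLp_comp_snd_of_mem_couplings hγ hμ)
    (memLp_comp_fst_of_mem_couplings hγ hSL)
  have i2 := MemLp.integrable_real_inner (memLp_comp_snd_of_mem_couplings hγ hμ)
    (memLp_comp_fst_of_mem_couplings hγ hTL)
  have i3 := MemLp.integrable_real_inner hμ hSL
  have i4 := MemLp.integrable_real_inner hμ hTL
  simp only [id] at i1 i2 i3 i4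
  simp only [inner_add_right, real_inner_smul_right]
  rw [integral_add (i1.const_mul a) (i2.const_mul b),
    integral_add (i3.const_mul a) (i4.const_mul b), integral_const_mul, integral_const_mul,
    integral_const_mul, integral_const_mul]
  exact add_le_add (mul_le_mul_of_nonneg_left (hS γ hγ) ha)
    (mul_le_mul_of_nonneg_left (hT γ hγ) hb)

variable [FiniteDimensional ℝ E] [BorelSpace E]

/-- A self-coupling `γ` yields the competing plan `(p.2, T p.1)` from `μ` to `ν`. All second moments
agree, so comparing costs is comparing correlations. -/
lemma IsOptimalPlan.isCorrelationMaximal {μ ν : Measure E} (hμ : MemLp id 2 μ) {T : E → E}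
    (hT : Measurable T) (hTL : MemLp T 2 μ)
    (hopt : IsOptimalPlan μ ν (μ.map fun x => (x, T x))) : IsCorrelationMaximal μ T := by
  intro γ hγ
  have hTν : μ.map T = ν := by
    rw [← hopt.1.2, Measure.snd, Measure.map_map measurable_snd (by fun_prop)]
    rfl
  have hm : Measurable fun p : E × E => (p.2, T p.1) := by fun_prop
  have hcoup : γ.map (fun p => (p.2, T p.1)) ∈ couplings μ ν := by
    constructor
    · rw [Measure.fst, Measure.map_map measurable_fst hm, ← hγ.2]
      rfl
    · rw [Measure.snd, Measure.map_map measurable_snd hm, ← hTν, ← hγ.1, Measure.fst,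
        Measure.map_map hT measurable_fst]
      rfl
  have h := hopt.2 _ hcoup
  rw [transportCost, transportCost, lintegral_map (by fun_prop) (by fun_prop),
    lintegral_map (by fun_prop) hm] at h
  refine (lintegral_enorm_sub_sq_le_iff (f := fun x => x) (g := T) (f' := fun p : E × E => p.2)
    (g' := fun p => T p.1) hμ hTL (memLp_comp_snd_of_mem_couplings hγ hμ)
    (memLp_comp_fst_of_mem_couplings hγ hTL) ?_ ?_).1 h
  · exact (lintegral_comp_snd_of_mem_couplings hγ (f := fun x => ‖x‖ₑ ^ 2) (by fun_prop)).symm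
  · exact (lintegral_comp_fst_of_mem_couplings hγ (f := fun x => ‖T x‖ₑ ^ 2) (by fun_prop)).symm

/-- Gluing turns a competing map `S` into a self-coupling of `μ` under which `(T p.1, p.2)` has the
law of `(S x, x)`; maximality then compares the correlations of `S` and `T` with the identity. -/
lemma IsCorrelationMaximal.lintegral_le {μ : Measure E} [IsProbabilityMeasure μ]
    (hμ : MemLp id 2 μ) {T : E → E} (hTL : MemLp T 2 μ) (hT : IsCorrelationMaximal μ T)
    {S : E → E} (hS : AEMeasurable S μ) (hST : μ.map S = μ.map T) :
    ∫⁻ x, ‖T x - x‖ₑ ^ 2 ∂μ ≤ ∫⁻ x, ‖S x - x‖ₑ ^ 2 ∂μ := by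
  have hTm := hTL.aemeasurable
  have hSL : MemLp S 2 μ := by
    have : MemLp id 2 (μ.map T) :=
      (memLp_map_measure_iff (by fun_prop) hTm).2 hTL
    rw [← hST] at this
    exact this.comp_of_map hS
  have hpair : AEMeasurable (fun x => (S x, x)) μ := hS.prodMk aemeasurable_id'
  have hcoup : μ.map (fun x => (S x, x)) ∈ couplings (μ.map T) μ := by
    constructor
    · rw [Measure.fst, AEMeasurable.map_map_of_aemeasurable measurable_fst.aemeasurable hpair,
        ← hST]
      rfl
    · rw [Measure.snd, AEMeasurable.map_map_of_aemeasurable measurable_snd.aemeasurable hpair]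
      exact Measure.map_id
  obtain ⟨m, hm, hmap⟩ := exists_glue hTm hcoup
  have hTfst : AEMeasurable (fun p : E × E => (T p.1, p.2)) m := by
    have h1 := memLp_comp_fst_of_mem_couplings hm hTL
    exact h1.aemeasurable.prodMk measurable_snd.aemeasurable
  have hcorr : ∫ p, ⟪p.2, T p.1⟫ ∂m = ∫ x, ⟪x, S x⟫ ∂μ := by
    have h1 : ∫ q, ⟪q.2, q.1⟫ ∂(m.map fun p => (T p.1, p.2)) = ∫ p, ⟪p.2, T p.1⟫ ∂m :=
      integral_map hTfst (by fun_prop)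
    have h2 : ∫ q : E × E, ⟪q.2, q.1⟫ ∂(μ.map fun x => (S x, x)) = ∫ x, ⟪x, S x⟫ ∂μ :=
      integral_map hpair (by fun_prop)
    rw [← h1, hmap, h2]
  have h := hT m hm
  rw [hcorr] at h
  simp_rw [← enorm_neg (T _ - _), ← enorm_neg (S _ - _), neg_sub]
  refine (lintegral_enorm_sub_sq_le_iff (f := fun x => x) (f' := fun x => x) hμ hTL hμ hSL
    rfl ?_).2 h
  rw [← lintegral_map' (f := fun y => ‖y‖ₑ ^ 2) (by fun_prop) hTm, ← hST,
    lintegral_map' (by fun_prop) hS]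

end Correlation

/-! ### Triangle inequality and symmetry for plans. -/

section Auxiliary

variable {X Y E : Type*} [MeasurableSpace X] [MeasurableSpace Y] [NormedAddCommGroup E]

lemma eLpNorm_comp_fst_of_mem_couplings {μ : Measure X} {ν : Measure Y} {π : Measure (X × Y)}
    (hπ : π ∈ couplings μ ν) {f : X → E} (hf : AEStronglyMeasurable f μ) :
    eLpNorm (fun p => f p.1) 2 π = eLpNorm f 2 μ := by
  have := hπ.1
  rw [← this] at hf ⊢
  exact (eLpNorm_map_measure hf measurable_fst.aemeasurable).symm

lemma eLpNorm_sub_le_eLpNorm_sub_add_eLpNorm_sub {μ : Measure X} {f g h : X → E}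
    (hf : AEStronglyMeasurable f μ) (hg : AEStronglyMeasurable g μ)
    (hh : AEStronglyMeasurable h μ) :
    eLpNorm (fun x => f x - h x) 2 μ ≤
      eLpNorm (fun x => f x - g x) 2 μ + eLpNorm (fun x => g x - h x) 2 μ := by
  have : (fun x => f x - h x) = (fun x => f x - g x) + fun x => g x - h x := by
    ext x; simp
  rw [this]
  exact eLpNorm_add_le (hf.sub hg) (hg.sub hh) (by norm_num)

lemma map_swap_mem_couplings [MeasurableSpace E] [BorelSpace E] [SecondCountableTopology E]
    {μ ν : Measure E} {γ : Measure (E × E)} (hγ : γ ∈ couplings μ ν) :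
    γ.map Prod.swap ∈ couplings ν μ ∧
      eLpNorm (fun p => p.1 - p.2) 2 (γ.map Prod.swap) = eLpNorm (fun p => p.1 - p.2) 2 γ := by
  refine ⟨⟨?_, ?_⟩, ?_⟩
  · rw [Measure.fst_map_swap, hγ.2]
  · rw [Measure.snd_map_swap, hγ.1]
  · rw [eLpNorm_map_measure (by fun_prop) (by fun_prop)]
    refine eLpNorm_congr_norm_ae (ae_of_all _ fun p => ?_)
    exact norm_sub_rev _ _

end Auxiliary

/-! ### Application to `P2` and the LOT map. -/

namespace P2

variable {n : ℕ}

lemma memLp_id (μ : P2 n) : MemLp id 2 μ.toMeasure := by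
  refine ⟨aestronglyMeasurable_id, ?_⟩
  have h : eLpNorm id 2 μ.toMeasure ^ 2 < ∞ := by
    rw [eLpNorm_two_sq]
    exact μ.secondMoment_lt_top
  simpa using h

lemma memLp_of_map_eq {σ ν : P2 n} {T : EuclideanSpace ℝ (Fin n) → EuclideanSpace ℝ (Fin n)}
    (hT : AEMeasurable T σ.toMeasure) (h : σ.toMeasure.map T = ν.toMeasure) :
    MemLp T 2 σ.toMeasure := by
  have := ν.memLp_id
  rw [← h] at this
  exact this.comp_of_map hT

/-- The image of an element of `𝒫₂` under a square integrable map. -/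
noncomputable def map (σ : P2 n) (T : EuclideanSpace ℝ (Fin n) → EuclideanSpace ℝ (Fin n))
    (hT : MemLp T 2 σ.toMeasure) : P2 n where
  toMeasure := σ.toMeasure.map T
  isProbabilityMeasure := Measure.isProbabilityMeasure_map hT.aemeasurable
  secondMoment_lt_top := by
    rw [lintegral_map' (by fun_prop) hT.aemeasurable, ← eLpNorm_two_sq]
    exact ENNReal.pow_lt_top hT.2

lemma rpow_half_eLpNorm (π : Measure (EuclideanSpace ℝ (Fin n) × EuclideanSpace ℝ (Fin n))) :
    (∫⁻ p, ‖p.1 - p.2‖ₑ ^ 2 ∂π) ^ (1 / 2 : ℝ) = eLpNorm (fun p => p.1 - p.2) 2 π := by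
  rw [← eLpNorm_two_sq (fun p : EuclideanSpace ℝ (Fin n) × EuclideanSpace ℝ (Fin n) => p.1 - p.2),
    ← ENNReal.rpow_natCast, ← ENNReal.rpow_mul]
  norm_num

lemma W2_le_eLpNorm {μ ν : P2 n}
    {π : Measure (EuclideanSpace ℝ (Fin n) × EuclideanSpace ℝ (Fin n))}
    (hπ : π ∈ couplings μ.toMeasure ν.toMeasure) :
    W2 μ ν ≤ eLpNorm (fun p => p.1 - p.2) 2 π := by
  rw [← rpow_half_eLpNorm]
  exact ENNReal.rpow_le_rpow (iInf₂_le π hπ) (by norm_num)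

lemma exists_coupling_of_W2_lt {μ ν : P2 n} {ε : ℝ≥0∞} (h : W2 μ ν < ε) :
    ∃ π ∈ couplings μ.toMeasure ν.toMeasure, eLpNorm (fun p => p.1 - p.2) 2 π < ε := by
  have h' := ENNReal.rpow_lt_rpow h (z := 2) (by norm_num)
  rw [W2, ← ENNReal.rpow_mul, one_div_mul_cancel (by norm_num), ENNReal.rpow_one] at h'
  simp only [iInf_lt_iff] at h'
  obtain ⟨π, hπ, hlt⟩ := h'
  refine ⟨π, hπ, ?_⟩
  have := ENNReal.rpow_lt_rpow hlt (z := (1 / 2 : ℝ)) (by norm_num)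
  rwa [rpow_half_eLpNorm, ← ENNReal.rpow_mul, mul_one_div_cancel (by norm_num),
    ENNReal.rpow_one] at this

section AbsolutelyContinuous

variable {σ : P2 n} (hσ : σ.toMeasure ≪ (volume : Measure (EuclideanSpace ℝ (Fin n))))

include hσ

/-- The minimum over all plans is attained by the graph of `T`, so a map optimal among maps induces
an optimal plan, and uniqueness of plans applies. -/
lemma isOptimalTransportMap_iff_ae_eq {ν : P2 n}
    {T : EuclideanSpace ℝ (Fin n) → EuclideanSpace ℝ (Fin n)} (hT : Measurable T)
    (hTν : σ.toMeasure.map T = ν.toMeasure)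
    (hopt : IsOptimalPlan σ.toMeasure ν.toMeasure (σ.toMeasure.map fun x => (x, T x)))
    (S : EuclideanSpace ℝ (Fin n) → EuclideanSpace ℝ (Fin n)) :
    IsOptimalTransportMap σ ν S ↔ S =ᵐ[σ.toMeasure] T := by
  constructor
  · rintro ⟨hS, hSν, hmin⟩
    refine ae_eq_of_map_graph_eq hS hT (IsOptimalPlan.eq hσ σ.memLp_id ν.memLp_id
      ⟨map_graph_mem_couplings hS hSν, fun π' hπ' => ?_⟩ hopt)
    refine le_trans ?_ (hopt.2 π' hπ')
    rw [transportCost_map_graph hS, transportCost_map_graph hT.aemeasurable]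
    exact hmin T hT.aemeasurable hTν
  · intro h
    refine ⟨hT.aemeasurable.congr h.symm, (Measure.map_congr h).trans hTν, fun S' hS' hS'ν => ?_⟩
    have hcost : ∫⁻ x, ‖S x - x‖ₑ ^ 2 ∂σ.toMeasure = ∫⁻ x, ‖T x - x‖ₑ ^ 2 ∂σ.toMeasure :=
      lintegral_congr_ae (h.mono fun x hx => by simp only; rw [hx])
    rw [hcost, ← transportCost_map_graph hT.aemeasurable, ← transportCost_map_graph hS']
    exact hopt.2 _ (map_graph_mem_couplings hS' hS'ν)

lemma exists_isOptimalPlan_LOT (ν : P2 n) :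
    ∃ T : EuclideanSpace ℝ (Fin n) → EuclideanSpace ℝ (Fin n), Measurable T ∧
      σ.toMeasure.map T = ν.toMeasure ∧
      IsOptimalPlan σ.toMeasure ν.toMeasure (σ.toMeasure.map fun x => (x, T x)) ∧
      LOT σ ν =ᵐ[σ.toMeasure] T := by
  obtain ⟨T, hT, hTν, hopt⟩ :=
    exists_measurable_isOptimalPlan_graph hσ ν.toMeasure σ.memLp_id ν.memLp_id
  refine ⟨T, hT, hTν, hopt, ?_⟩
  rw [← isOptimalTransportMap_iff_ae_eq hσ hT hTν hopt]
  have hTL := memLp_of_map_eq hT.aemeasurable hTν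
  exact Classical.epsilon_spec (p := fun T : Lp (EuclideanSpace ℝ (Fin n)) 2 σ.toMeasure =>
    IsOptimalTransportMap σ ν T)
    ⟨hTL.toLp T, (isOptimalTransportMap_iff_ae_eq hσ hT hTν hopt _).2 hTL.coeFn_toLp⟩

lemma isOptimalTransportMap_iff_eq_LOT (ν : P2 n)
    (T : Lp (EuclideanSpace ℝ (Fin n)) 2 σ.toMeasure) :
    IsOptimalTransportMap σ ν T ↔ T = LOT σ ν := by
  obtain ⟨T₀, hT₀, hT₀ν, hopt, hLOT⟩ := exists_isOptimalPlan_LOT hσ ν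
  rw [isOptimalTransportMap_iff_ae_eq hσ hT₀ hT₀ν hopt]
  exact ⟨fun h => Lp.ext (h.trans hLOT.symm), fun h => h ▸ hLOT⟩

lemma map_LOT (ν : P2 n) : σ.toMeasure.map (LOT σ ν) = ν.toMeasure :=
  ((isOptimalTransportMap_iff_eq_LOT hσ ν _).2 rfl).2.1

lemma LOT_injective : Function.Injective (LOT σ) := by
  intro μ ν h
  ext1
  rw [← map_LOT hσ μ, ← map_LOT hσ ν, h]

lemma W2_le_edist_LOT (μ ν : P2 n) : W2 μ ν ≤ edist (LOT σ μ) (LOT σ ν) := by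
  have h1 := (Lp.memLp (LOT σ μ)).aemeasurable
  have h2 := (Lp.memLp (LOT σ ν)).aemeasurable
  have hpair := h1.prodMk h2
  have hcoup : σ.toMeasure.map (fun x => (LOT σ μ x, LOT σ ν x)) ∈
      couplings μ.toMeasure ν.toMeasure := by
    constructor
    · rw [Measure.fst, AEMeasurable.map_map_of_aemeasurable measurable_fst.aemeasurable hpair]
      exact map_LOT hσ μ
    · rw [Measure.snd, AEMeasurable.map_map_of_aemeasurable measurable_snd.aemeasurable hpair]
      exact map_LOT hσ ν
  refine (W2_le_eLpNorm hcoup).trans (le_of_eq ?_)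
  rw [eLpNorm_map_measure (by fun_prop) hpair, Lp.edist_def]
  rfl

lemma eLpNorm_sub_LOT_le_of_mem_couplings {ν : P2 n}
    {m : Measure (EuclideanSpace ℝ (Fin n) × EuclideanSpace ℝ (Fin n))}
    (hm : m ∈ couplings σ.toMeasure ν.toMeasure) :
    eLpNorm (fun x => x - LOT σ ν x) 2 σ.toMeasure ≤ eLpNorm (fun p => p.1 - p.2) 2 m := by
  obtain ⟨T, hT, hTν, hopt, hLOT⟩ := exists_isOptimalPlan_LOT hσ ν
  have h := hopt.2 m hm
  rw [transportCost_eq_eLpNorm_sq, transportCost_eq_eLpNorm_sq,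
    ENNReal.pow_le_pow_left_iff two_ne_zero, eLpNorm_map_measure (by fun_prop) (by fun_prop)] at h
  refine le_trans (le_of_eq (eLpNorm_congr_ae ?_)) h
  filter_upwards [hLOT] with x hx
  rw [hx]
  rfl

/-- A plan from `μ` to `ν` lifts along the optimal map from `σ` to `μ`. -/
lemma exists_lift_LOT {μ ν : P2 n}
    {γ : Measure (EuclideanSpace ℝ (Fin n) × EuclideanSpace ℝ (Fin n))}
    (hγ : γ ∈ couplings μ.toMeasure ν.toMeasure) :
    ∃ m ∈ couplings σ.toMeasure ν.toMeasure,
      eLpNorm (fun p => LOT σ μ p.1 - p.2) 2 m = eLpNorm (fun p => p.1 - p.2) 2 γ := by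
  have hL := Lp.memLp (LOT σ μ)
  rw [← map_LOT hσ μ] at hγ
  obtain ⟨m, hm, hmap⟩ := exists_glue hL.aemeasurable hγ
  refine ⟨m, hm, ?_⟩
  rw [← hmap, eLpNorm_map_measure (by fun_prop)
    ((memLp_comp_fst_of_mem_couplings hm hL).aemeasurable.prodMk measurable_snd.aemeasurable)]
  rfl

/-- This is the triangle inequality for `W2` from `σ`, with `‖x - LOT σ ν x‖` in `L²` playing the
role of the distance from `σ` to `ν`. -/
lemma eLpNorm_sub_LOT_le {μ ν : P2 n}
    {γ : Measure (EuclideanSpace ℝ (Fin n) × EuclideanSpace ℝ (Fin n))}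
    (hγ : γ ∈ couplings μ.toMeasure ν.toMeasure) :
    eLpNorm (fun x => x - LOT σ ν x) 2 σ.toMeasure ≤
      eLpNorm (fun x => x - LOT σ μ x) 2 σ.toMeasure + eLpNorm (fun p => p.1 - p.2) 2 γ := by
  have hL := Lp.memLp (LOT σ μ)
  obtain ⟨m, hm, hmγ⟩ := exists_lift_LOT hσ hγ
  refine (eLpNorm_sub_LOT_le_of_mem_couplings hσ hm).trans ?_
  rw [← hmγ, ← eLpNorm_comp_fst_of_mem_couplings hm (f := fun x => x - LOT σ μ x)
    (σ.memLp_id.sub hL).1]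
  exact eLpNorm_sub_le_eLpNorm_sub_add_eLpNorm_sub measurable_fst.aestronglyMeasurable
    (memLp_comp_fst_of_mem_couplings hm hL).1 measurable_snd.aestronglyMeasurable

lemma exists_forall_eLpNorm_sub_LOT_le (ν : P2 n) {ε : ℝ≥0∞} (hε : 0 < ε) :
    ∃ δ : ℝ≥0∞, 0 < δ ∧ ∀ m ∈ couplings σ.toMeasure ν.toMeasure,
      eLpNorm (fun p => p.1 - p.2) 2 m < eLpNorm (fun x => x - LOT σ ν x) 2 σ.toMeasure + δ →
        eLpNorm (fun p => p.2 - LOT σ ν p.1) 2 m ≤ ε := by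
  obtain ⟨T, hT, hTν, hopt, hLOT⟩ := exists_isOptimalPlan_LOT hσ ν
  obtain ⟨δ, hδ, h⟩ :=
    hopt.exists_forall_eLpNorm_le hσ σ.memLp_id ν.memLp_id hT hTν hε
  have hdist : eLpNorm (fun x => x - LOT σ ν x) 2 σ.toMeasure =
      eLpNorm (fun x => x - T x) 2 σ.toMeasure :=
    eLpNorm_congr_ae (hLOT.mono fun x hx => by simp only; rw [hx])
  refine ⟨δ, hδ, fun m hm hlt => ?_⟩
  rw [hdist] at hlt
  refine le_trans (le_of_eq (eLpNorm_congr_ae ?_)) (h m hm hlt)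
  exact (ae_comp_fst_of_mem_couplings hm hLOT).mono fun p hp => by simp only at hp ⊢; rw [hp]

/-- A plan between `μ` and `ν` lifts to a plan from `σ` to `ν` which is close to the plan induced
by the optimal map to `μ`, and nearly optimal. -/
lemma exists_nearly_optimal_lift {μ ν : P2 n}
    {γ : Measure (EuclideanSpace ℝ (Fin n) × EuclideanSpace ℝ (Fin n))}
    (hγ : γ ∈ couplings μ.toMeasure ν.toMeasure) :
    ∃ m ∈ couplings σ.toMeasure ν.toMeasure,
      eLpNorm (fun p => LOT σ μ p.1 - p.2) 2 m = eLpNorm (fun p => p.1 - p.2) 2 γ ∧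
      eLpNorm (fun p => p.1 - p.2) 2 m ≤ eLpNorm (fun x => x - LOT σ ν x) 2 σ.toMeasure +
        (eLpNorm (fun p => p.1 - p.2) 2 γ + eLpNorm (fun p => p.1 - p.2) 2 γ) := by
  obtain ⟨m, hm, hmγ⟩ := exists_lift_LOT hσ hγ
  obtain ⟨hγ', hswap⟩ := map_swap_mem_couplings hγ
  have hL := Lp.memLp (LOT σ μ)
  refine ⟨m, hm, hmγ, ?_⟩
  have h1 : eLpNorm (fun p => p.1 - p.2) 2 m ≤ eLpNorm (fun p => p.1 - LOT σ μ p.1) 2 m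
      + eLpNorm (fun p => LOT σ μ p.1 - p.2) 2 m :=
    eLpNorm_sub_le_eLpNorm_sub_add_eLpNorm_sub measurable_fst.aestronglyMeasurable
      (memLp_comp_fst_of_mem_couplings hm hL).1 measurable_snd.aestronglyMeasurable
  have h2 := eLpNorm_sub_LOT_le hσ hγ'
  rw [eLpNorm_comp_fst_of_mem_couplings hm (f := fun x => x - LOT σ μ x)
    (σ.memLp_id.sub hL).1, hmγ] at h1
  rw [hswap] at h2
  rw [← add_assoc]
  exact h1.trans (add_le_add_left h2 _)

lemma continuous_LOT : Continuous (LOT σ) := by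
  refine continuous_def.2 fun U hU ν hν => ?_
  obtain ⟨ε, hε, hεU⟩ := EMetric.isOpen_iff.1 hU _ hν
  have hε2 : 0 < ε / 2 := ENNReal.half_pos hε.ne'
  obtain ⟨δ, hδ, h⟩ := exists_forall_eLpNorm_sub_LOT_le hσ ν hε2
  have hδ2 : 0 < δ / 2 := ENNReal.half_pos hδ.ne'
  -- The lifted plan exceeds the optimum by at most twice the cost of the coupling, hence `δ / 2`.
  -- Its second coordinate is then close to both `LOT σ μ` and `LOT σ ν`, with `ε / 2` allotted to
  -- each.
  refine ⟨min (ε / 2) (δ / 2), lt_min hε2 hδ2, fun μ hμ => hεU ?_⟩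
  have hLν := Lp.memLp (LOT σ ν)
  have hLμ := Lp.memLp (LOT σ μ)
  obtain ⟨γ, hγ, hγlt⟩ := exists_coupling_of_W2_lt hμ
  obtain ⟨hγ', hswap⟩ := map_swap_mem_couplings hγ
  obtain ⟨m, hm, hmγ, hmle⟩ := exists_nearly_optimal_lift hσ hγ'
  rw [hswap] at hmγ hmle
  have hfin : eLpNorm (fun x => x - LOT σ ν x) 2 σ.toMeasure ≠ ∞ := (σ.memLp_id.sub hLν).2.ne
  have hlt := hγlt.trans_le (min_le_right _ _)
  have hnear := h m hm (hmle.trans_lt (ENNReal.add_lt_add_left hfin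
    ((ENNReal.add_lt_add hlt hlt).trans_eq (ENNReal.add_halves δ))))
  have hnear_fin : eLpNorm (fun p => p.2 - LOT σ ν p.1) 2 m ≠ ∞ :=
    ((memLp_comp_snd_of_mem_couplings hm ν.memLp_id).sub
      (memLp_comp_fst_of_mem_couplings hm hLν)).2.ne
  have hsum : eLpNorm (fun p => LOT σ μ p.1 - LOT σ ν p.1) 2 m ≤
      eLpNorm (fun p => LOT σ μ p.1 - p.2) 2 m + eLpNorm (fun p => p.2 - LOT σ ν p.1) 2 m :=
    eLpNorm_sub_le_eLpNorm_sub_add_eLpNorm_sub (memLp_comp_fst_of_mem_couplings hm hLμ).1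
      measurable_snd.aestronglyMeasurable (memLp_comp_fst_of_mem_couplings hm hLν).1
  rw [eLpNorm_comp_fst_of_mem_couplings hm (f := fun x => LOT σ μ x - LOT σ ν x)
    (hLμ.sub hLν).1, hmγ] at hsum
  rw [Metric.mem_eball, Lp.edist_def]
  exact hsum.trans_lt ((ENNReal.add_lt_add_of_lt_of_le hnear_fin
    (hγlt.trans_le (min_le_left _ _)) hnear).trans_eq (ENNReal.add_halves ε))

/-- Since `W2` is at most the `L²` distance, an open `U` is the preimage of the union of the `L²`
balls around the images of its points, with the Wasserstein radii. -/
lemma isEmbedding_LOT : Topology.IsEmbedding (LOT σ) := by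
  refine ⟨⟨le_antisymm (continuous_LOT hσ).le_induced ?_⟩, LOT_injective hσ⟩
  intro U hU
  choose! ε hε h using hU
  refine ⟨⋃ μ ∈ U, Metric.eball (LOT σ μ) (ε μ), ?_, ?_⟩
  · exact isOpen_biUnion fun μ _ => Metric.isOpen_eball
  · ext ν
    simp only [Set.mem_preimage, Set.mem_iUnion, exists_prop]
    constructor
    · rintro ⟨μ, hμ, hlt⟩
      rw [Metric.mem_eball, edist_comm] at hlt
      exact h μ hμ ν ((W2_le_edist_LOT hσ μ ν).trans_lt hlt)
    · intro hν
      exact ⟨ν, hν, Metric.mem_eball_self (hε ν hν)⟩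

lemma isCorrelationMaximal_LOT (ν : P2 n) : IsCorrelationMaximal σ.toMeasure (LOT σ ν) := by
  obtain ⟨T, hT, hTν, hopt, hLOT⟩ := exists_isOptimalPlan_LOT hσ ν
  exact (hopt.isCorrelationMaximal σ.memLp_id hT (memLp_of_map_eq hT.aemeasurable hTν)).congr_ae
    hLOT.symm

lemma convex_range_LOT : Convex ℝ (Set.range (LOT σ)) := by
  rintro _ ⟨μ, rfl⟩ _ ⟨ν, rfl⟩ a b ha hb -
  set R := a • LOT σ μ + b • LOT σ ν with hR
  have hRae : (fun x => a • LOT σ μ x + b • LOT σ ν x) =ᵐ[σ.toMeasure] R := by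
    filter_upwards [Lp.coeFn_add (a • LOT σ μ) (b • LOT σ ν), Lp.coeFn_smul a (LOT σ μ),
      Lp.coeFn_smul b (LOT σ ν)] with x h1 h2 h3
    rw [hR, h1, Pi.add_apply, h2, h3, Pi.smul_apply, Pi.smul_apply]
  have hmax : IsCorrelationMaximal σ.toMeasure R :=
    ((isCorrelationMaximal_LOT hσ μ).add_smul σ.memLp_id (Lp.memLp _) (Lp.memLp _)
      (isCorrelationMaximal_LOT hσ ν) ha hb).congr_ae hRae
  have hRL := Lp.memLp R
  -- The combination `R` is the optimal map onto its own image measure.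
  refine ⟨σ.map R hRL, ((isOptimalTransportMap_iff_eq_LOT hσ _ R).1
    ⟨hRL.aemeasurable, rfl, fun S hS hSR => ?_⟩).symm⟩
  exact hmax.lintegral_le σ.memLp_id hRL hS hSR

end AbsolutelyContinuous

end P2

theorem mainTheorem9 (n : ℕ) (σ : P2 n)
    (hσ : σ.toMeasure ≪ (volume : Measure (EuclideanSpace ℝ (Fin n)))) :
    -- `P2.LOT σ ν` is the optimal transport map from `σ` to `ν`, which exists and is unique
    (∀ (ν : P2 n) (T : Lp (EuclideanSpace ℝ (Fin n)) 2 σ.toMeasure),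
      P2.IsOptimalTransportMap σ ν T ↔ T = P2.LOT σ ν) ∧
    Function.Injective (P2.LOT σ) ∧
    Continuous (P2.LOT σ) ∧
    Topology.IsEmbedding (P2.LOT σ) ∧
    Convex ℝ (Set.range (P2.LOT σ)) :=
  ⟨P2.isOptimalTransportMap_iff_eq_LOT hσ, P2.LOT_injective hσ, P2.continuous_LOT hσ,
    P2.isEmbedding_LOT hσ, P2.convex_range_LOT hσ⟩
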